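/- Let $G$ be a finite $2$-group, that is, a finite group whose order is a power of $2$. Say that $G$ has the cut-property if every central unit of the integral group ring $\mathbb{Z}[G]$ is trivial, i.e. if every element of the centre of the unit group $\mathcal{U}(\mathbb{Z}[G])$ has the form $\pm g$ with $g$ in the centre of $G$. Then $G$ has the cut-property if and only if, for every $x\in G$, $x^3$ is conjugate in $G$ to $x$ or to $x^{-1}$. Furthermore, suppose that $G$ has the cut-property, and let $G=\gamma_1(G)\supseteq\gamma_2(G)\supseteq\cdots$ and $\langle 1\rangle=\mathcal{Z}_0(G)\subseteq\mathcal{Z}_1(G)\subseteq\cdots$ be the lower and the upper central series of $G$. Then each nontrivial quotient $\gamma_i(G)/\gamma_{i+1}(G)$ $(i\ge 1)$ and each nontrivial quotient $\mathcal{Z}_{i+1}(G)/\mathcal{Z}_i(G)$ $(i\ge 0)$ has exponent $2$ or $4$. -/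

import Mathlib

/-- The cut-property: every central unit of the integral group ring `ℤ[G]` is trivial, i.e. every
element of the centre of the unit group of `ℤ[G]` is of the form `g` or `-g` with `g` in the
centre of `G`. -/
def HasCutProperty (G : Type*) [Group G] : Prop :=
  ∀ u ∈ Subgroup.center (MonoidAlgebra ℤ G)ˣ, ∃ g ∈ Subgroup.center G,
    (u : MonoidAlgebra ℤ G) = MonoidAlgebra.of ℤ G g ∨
    (u : MonoidAlgebra ℤ G) = -MonoidAlgebra.of ℤ G g

/-! Everything rests on the trace of left multiplication on a group ring `K[G]`: multiplication by
`a` has trace `|G| * a.coeff 1`. So a central idempotent `e` has `|G| * e.coeff h` as the trace of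
`e * h⁻¹`, whose eigenvalues are `0` or roots of unity, and Galois automorphisms act on the
coefficients by `h ↦ h ^ j` (`coeff_pow_of_isIdempotentElem`).

Conjugacy implies cut: let `u` be a central unit, `u*` its image under inversion, `v = u u*`. The
coefficients of `v` are invariant under conjugation and inversion, hence under cubing, hence under
all odd powers, because `-1` and `3` generate the units modulo `2 ^ m`. The eigenvalues of `v` on
central idempotents are then Galois-fixed algebraic integers with integral inverses, so they are
`±1` and `v ^ 2 = 1`. Comparing coefficients at `1` gives `∑ u_g ^ 2 = 1`, so `u = ±g`.

Cut implies conjugacy: the inversion-symmetric part of the centre of `ℚ[G]` is a product of totally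
real fields `K`. A suitable power of a unit of `𝓞 K` lifts to a central unit of `ℤ[G]`, which is
trivial, so `𝓞 K` has only torsion units and Dirichlet forces `K = ℚ`. Symmetric central elements
are thus rational combinations of rational central idempotents, with coefficients invariant under
cubing. The indicator of the classes of `x` and `x⁻¹` gives the claim.

In a central section conjugate elements coincide, so `y ^ 3 = y` or `y ^ 3 = y⁻¹`, and `y ^ 4 = 1`.
-/

/-! ### Traces of powers of semisimple endomorphisms -/

open Module in
theorem Module.End.trace_pow_eq_sum_eigenspaces {K V : Type*} [Field K] [IsAlgClosed K]
    [AddCommGroup V] [Module K V] [FiniteDimensional K V] {f : End K V} (hf : f.IsSemisimple) :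
    ∃ s : Finset K, (∀ μ ∈ s, f.HasEigenvalue μ) ∧
      ∀ j : ℕ, LinearMap.trace K V (f ^ j) =
        ∑ μ ∈ s, μ ^ j * (finrank K (f.eigenspace μ) : K) := by
  classical
  have hds := DirectSum.isInternal_submodule_of_iSupIndep_of_iSup_eq_top
    f.eigenspaces_iSupIndep hf.iSup_eigenspace_eq_top
  have hfin : {μ | f.eigenspace μ ≠ ⊥}.Finite :=
    WellFoundedGT.finite_ne_bot_of_iSupIndep f.eigenspaces_iSupIndep
  refine ⟨hfin.toFinset, fun μ hμ => by simpa [HasEigenvalue, HasUnifEigenvalue] using hμ,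
    fun j => ?_⟩
  have key : ∀ μ, ∀ x ∈ f.eigenspace μ, (f ^ j) x = μ ^ j • x := fun μ x hx => by
    induction j with
    | zero => simp
    | succ j ih =>
      rw [pow_succ', Module.End.mul_apply, ih, map_smul, mem_eigenspace_iff.1 hx, smul_smul,
        pow_succ]
  have hmaps : ∀ μ, Set.MapsTo (f ^ j) (f.eigenspace μ) (f.eigenspace μ) := fun μ x hx => by
    have hx' : x ∈ f.eigenspace μ := hx
    rw [SetLike.mem_coe, key μ x hx']
    exact Submodule.smul_mem _ _ hx'
  rw [LinearMap.trace_eq_sum_trace_restrict' hds hfin hmaps]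
  refine Finset.sum_congr rfl fun μ _ => ?_
  have : (f ^ j).restrict (hmaps μ) = μ ^ j • LinearMap.id := by
    ext x
    exact key μ x x.2
  rw [this, map_smul, LinearMap.trace_id, smul_eq_mul]

open Module Polynomial in
/-- If `f ^ (n + 1) = f`, a ring automorphism raising `n`-th roots of unity to the `j`-th power
carries the trace of `f` to the trace of `f ^ j`. -/
theorem Module.End.trace_pow_eq_of_pow_succ_eq {K V : Type*} [Field K] [IsAlgClosed K] [CharZero K]
    [AddCommGroup V] [Module K V] [FiniteDimensional K V] {f : End K V} {n : ℕ} (hn : n ≠ 0)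
    (hf : f ^ (n + 1) = f) {F : Type*} [FunLike F K K] [RingHomClass F K K] (τ : F) {j : ℕ}
    (hj : j ≠ 0) (hτ : ∀ μ : K, μ ^ n = 1 → τ μ = μ ^ j) :
    LinearMap.trace K V (f ^ j) = τ (LinearMap.trace K V f) := by
  have hsep : (X ^ (n + 1) - X : K[X]).Separable := by
    have h1 : (X ^ (n + 1) - X : K[X]) = X * (X ^ n - 1) := by ring
    have h2 : (X ^ n - 1 : K[X]).Separable := by
      have := separable_X_pow_sub_C (F := K) (n := n) 1 (by exact_mod_cast hn) one_ne_zero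
      simpa using this
    rw [h1]
    refine separable_X.mul h2 ?_
    refine ⟨X ^ (n - 1), -1, ?_⟩
    rw [← pow_succ, Nat.sub_add_cancel (Nat.one_le_iff_ne_zero.2 hn)]
    ring
  have hss : f.IsSemisimple :=
    isSemisimple_of_squarefree_aeval_eq_zero hsep.squarefree (by simp [hf])
  obtain ⟨s, hs, htr⟩ := Module.End.trace_pow_eq_sum_eigenspaces hss
  have h1 := htr 1
  rw [pow_one] at h1
  rw [htr j, h1, map_sum]
  refine Finset.sum_congr rfl fun μ hμ => ?_
  rw [pow_one, map_mul, map_natCast]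
  congr 1
  by_cases h0 : μ = 0
  · simp [h0, hj]
  · refine (hτ μ ?_).symm
    obtain ⟨x, hx⟩ := (hs μ hμ).exists_hasEigenvector
    have h2 : (f ^ (n + 1)) x = μ ^ (n + 1) • x := hx.pow_apply _
    rw [hf, hx.apply_eq_smul] at h2
    have h3 := smul_left_injective K hx.2 h2
    simp only [pow_succ] at h3
    exact (mul_right_cancel₀ h0 (by rw [one_mul]; exact h3)).symm

/-! ### Coefficients, traces and central idempotents in group rings -/

namespace MonoidAlgebra

variable {R G : Type*} [Group G]

theorem coeff_mul_single' [Semiring R] (a : MonoidAlgebra R G) (g h : G) (r : R) :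
    (a * single g r).coeff h = a.coeff (h * g⁻¹) * r :=
  coeff_mul_single_eq_coeff_mul _ fun x _ => by rw [eq_mul_inv_iff_mul_eq]

theorem coeff_single_mul' [Semiring R] (a : MonoidAlgebra R G) (g h : G) (r : R) :
    (single g r * a).coeff h = r * a.coeff (g⁻¹ * h) :=
  coeff_single_mul_eq_mul_coeff _ fun x _ => by rw [eq_inv_mul_iff_mul_eq]

theorem coeff_mul_eq_sum [Semiring R] [Fintype G] (a b : MonoidAlgebra R G) (g : G) :
    (a * b).coeff g = ∑ h, a.coeff h * b.coeff (h⁻¹ * g) := by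
  classical
  rw [coeff_mul_antidiag a b g (Finset.univ.image fun h : G => (h, h⁻¹ * g)), Finset.sum_image]
  · intro x _ y _ hxy
    exact (Prod.ext_iff.1 hxy).1
  · rintro ⟨p, q⟩
    simp only [Finset.mem_image, Finset.mem_univ, true_and, Prod.mk.injEq]
    constructor
    · rintro ⟨x, rfl, rfl⟩
      simp
    · rintro rfl
      exact ⟨p, rfl, by simp⟩

theorem coeff_conj_of_commute [Semiring R] {a : MonoidAlgebra R G} {g : G}
    (ha : Commute a (single g 1)) (h : G) : a.coeff (g * h * g⁻¹) = a.coeff h := by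
  have := congrArg (fun z => z.coeff (g * h)) ha.eq
  simpa [coeff_mul_single', coeff_single_mul'] using this

theorem commute_of_forall_single [CommSemiring R] {a : MonoidAlgebra R G}
    (ha : ∀ g, Commute a (single g 1)) (b : MonoidAlgebra R G) : Commute a b := by
  induction b using MonoidAlgebra.induction_on with
  | of g => exact ha g
  | add x y hx hy => exact hx.add_right hy
  | smul r x hx => exact hx.smul_right r

theorem commute_of_coeff_conj [CommSemiring R] {a : MonoidAlgebra R G}
    (ha : ∀ g h, a.coeff (g * h * g⁻¹) = a.coeff h) (b : MonoidAlgebra R G) : Commute a b := by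
  refine commute_of_forall_single (fun g => ?_) b
  ext h
  rw [coeff_mul_single', coeff_single_mul', mul_one, one_mul, ← ha g (g⁻¹ * h)]
  simp

theorem trace_mulLeft {K : Type*} [CommRing K] [Finite G] (a : MonoidAlgebra K G) :
    LinearMap.trace K _ (LinearMap.mulLeft K a) = Nat.card G * a.coeff 1 := by
  classical
  have := Fintype.ofFinite G
  rw [LinearMap.trace_eq_matrix_trace K (MonoidAlgebra.basis G K), Matrix.trace]
  have : ∀ g : G, Matrix.diag (LinearMap.toMatrix (MonoidAlgebra.basis G K)
      (MonoidAlgebra.basis G K) (LinearMap.mulLeft K a)) g = a.coeff 1 := fun g => by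
    rw [Matrix.diag_apply, LinearMap.toMatrix_apply, basis_apply, LinearMap.mulLeft_apply]
    change (a * single g 1).coeff g = _
    simp
  rw [Finset.sum_congr rfl fun g _ => this g]
  simp [Nat.card_eq_fintype_card]

theorem isReduced_center (K G : Type*) [Group G] [Finite G] [Field K] [CharZero K] :
    IsReduced (Subalgebra.center K (MonoidAlgebra K G)) := by
  refine ⟨fun z hz => ?_⟩
  obtain ⟨z, hzc⟩ := z
  obtain ⟨k, hk⟩ := hz
  have hk' : z ^ k = 0 := congrArg Subtype.val hk
  refine Subtype.ext ?_
  change z = 0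
  ext g
  -- Centrality makes `z * g⁻¹` nilpotent along with `z`; its trace is `|G| * z.coeff g`.
  have hn : IsNilpotent (LinearMap.mulLeft K (z * single g⁻¹ 1)) := by
    refine ⟨k, ?_⟩
    have hc : Commute z (single g⁻¹ 1) := (Subalgebra.mem_center_iff.1 hzc _).symm
    rw [LinearMap.pow_mulLeft, hc.mul_pow, hk', zero_mul, LinearMap.mulLeft_zero_eq_zero]
  have h := (LinearMap.isNilpotent_trace_of_isNilpotent hn).eq_zero
  rw [trace_mulLeft, coeff_mul_single'] at h
  simpa [Nat.card_pos.ne'] using h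

theorem coeff_one_ne_zero_of_isIdempotentElem {K : Type*} [Field K] [CharZero K] [Finite G]
    {e : MonoidAlgebra K G} (he : IsIdempotentElem e) (h0 : e ≠ 0) : e.coeff 1 ≠ 0 := by
  intro h1
  have hi : IsIdempotentElem (LinearMap.mulLeft K e) := by
    rw [IsIdempotentElem, Module.End.mul_eq_comp, ← LinearMap.mulLeft_mul, he.eq]
  have := (LinearMap.IsIdempotentElem.trace_eq_zero_iff hi).1 (by rw [trace_mulLeft, h1, mul_zero])
  apply h0
  simpa using LinearMap.congr_fun this 1

/-- Galois action on the coefficients of a central idempotent. -/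
theorem coeff_pow_of_isIdempotentElem {K : Type*} [Field K] [IsAlgClosed K] [CharZero K]
    [Finite G] {e : MonoidAlgebra K G} (he : IsIdempotentElem e)
    (hc : e ∈ Subalgebra.center K (MonoidAlgebra K G))
    {F : Type*} [FunLike F K K] [RingHomClass F K K] (τ : F) {j : ℕ}
    (hj : j ≠ 0) (hτ : ∀ μ : K, μ ^ Nat.card G = 1 → τ μ = μ ^ j) (h : G) :
    e.coeff (h ^ j) = τ (e.coeff h) := by
  have hpow : ∀ k : ℕ, k ≠ 0 →
      LinearMap.mulLeft K (e * single h⁻¹ 1) ^ k = LinearMap.mulLeft K (e * single (h⁻¹ ^ k) 1) := by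
    intro k hk
    have hcom : Commute e (single h⁻¹ 1) := (Subalgebra.mem_center_iff.1 hc _).symm
    rw [LinearMap.pow_mulLeft, hcom.mul_pow, he.pow_eq hk, single_pow, one_pow]
  have hs : LinearMap.mulLeft K (e * single h⁻¹ 1) ^ (Nat.card G + 1) =
      LinearMap.mulLeft K (e * single h⁻¹ 1) := by
    rw [hpow _ (Nat.succ_ne_zero _), pow_succ, pow_card_eq_one', one_mul]
  have := Module.End.trace_pow_eq_of_pow_succ_eq Nat.card_pos.ne' hs τ hj hτ
  rw [hpow j hj, trace_mulLeft, trace_mulLeft, map_mul, map_natCast, coeff_mul_single',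
    coeff_mul_single'] at this
  have h2 := mul_left_cancel₀ (Nat.cast_ne_zero.2 (Nat.card_pos (α := G)).ne') this
  simpa using h2

end MonoidAlgebra

/-! ### Galois action on roots of unity and rationality of eigenvalues -/

theorem AlgebraicClosure.isAlgClosure_rat :
    @IsAlgClosure ℚ (AlgebraicClosure ℚ) _ _ DivisionRing.toRatAlgebra _ := by
  rw [Subsingleton.elim DivisionRing.toRatAlgebra 
    (AlgebraicClosure.instAlgebra ℚ)]
  infer_instance

-- `ζ` and `ζ ^ j` are both roots of the irreducible `n`-th cyclotomic polynomial.
open Polynomial in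
theorem IsPrimitiveRoot.exists_algEquiv_pow {L : Type*} [Field L] [CharZero L]
    [Normal ℚ L] {n : ℕ} (hn : n ≠ 0) {ζ : L} (hζ : IsPrimitiveRoot ζ n) {j : ℕ}
    (hj : j.Coprime n) : ∃ τ : L ≃ₐ[ℚ] L, ∀ μ : L, μ ^ n = 1 → τ μ = μ ^ j := by
  have hpos := Nat.pos_of_ne_zero hn
  have : NeZero n := ⟨hn⟩
  have hmin : aeval (ζ ^ j) (minpoly ℚ ζ) = 0 := by
    rw [← cyclotomic_eq_minpoly_rat hζ hpos,
      cyclotomic_eq_minpoly_rat (hζ.pow_of_coprime j hj) hpos]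
    exact minpoly.aeval _ _
  obtain ⟨τ, hτ⟩ := minpoly.exists_algEquiv_of_root'
    (hζ.isIntegral hpos).tower_top.isAlgebraic hmin
  refine ⟨τ, fun μ hμ => ?_⟩
  obtain ⟨k, -, rfl⟩ := hζ.eq_pow_of_pow_eq_one hμ
  rw [map_pow, hτ, pow_right_comm]

theorem IsPrimitiveRoot.exists_coprime_pow {L F : Type*} [Field L] [FunLike F L L]
    [RingHomClass F L L] {n : ℕ} (hn : n ≠ 0) {ζ : L} (hζ : IsPrimitiveRoot ζ n) (τ : F) :
    ∃ j : ℕ, j ≠ 0 ∧ j.Coprime n ∧ ∀ μ : L, μ ^ n = 1 → τ μ = μ ^ j := by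
  have : NeZero n := ⟨hn⟩
  obtain ⟨i, -, hi⟩ := hζ.eq_pow_of_pow_eq_one (ξ := τ ζ) (by rw [← map_pow, hζ.pow_eq_one, map_one])
  -- Adding `n` keeps the exponent nonzero, as needed for the eigenvalue `0` and for `e ^ j = e`.
  have hi' : ζ ^ (i + n) = τ ζ := by rw [pow_add, hi, hζ.pow_eq_one, mul_one]
  refine ⟨i + n, by omega, ?_, fun μ hμ => ?_⟩
  · rw [← hζ.pow_iff_coprime (Nat.pos_of_ne_zero hn), hi']
    exact hζ.map_of_injective (f := τ) (RingHom.injective (τ : L →+* L))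
  · obtain ⟨k, -, rfl⟩ := hζ.eq_pow_of_pow_eq_one hμ
    rw [map_pow, ← hi', pow_right_comm]

namespace MonoidAlgebra

variable {G : Type*} [Group G] [Finite G]


/-- Coefficients of rational central idempotents are constant on generators of cyclic subgroups. -/
theorem coeff_pow_of_isIdempotentElem_rat {e : MonoidAlgebra ℚ G} (he : IsIdempotentElem e)
    (hc : e ∈ Subalgebra.center ℚ (MonoidAlgebra ℚ G)) {j : ℕ} (hj : j ≠ 0)
    (hjn : j.Coprime (Nat.card G)) (h : G) : e.coeff (h ^ j) = e.coeff h := by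
  have hn : Nat.card G ≠ 0 := Nat.card_pos.ne'
  have := AlgebraicClosure.isAlgClosure_rat
  have : Normal ℚ (AlgebraicClosure ℚ) := IsAlgClosure.normal ℚ _
  have : NeZero ((Nat.card G : ℕ) : AlgebraicClosure ℚ) := ⟨by exact_mod_cast hn⟩
  obtain ⟨ζ, hζ⟩ := HasEnoughRootsOfUnity.exists_primitiveRoot (AlgebraicClosure ℚ) (Nat.card G)
  obtain ⟨τ, hτ⟩ := hζ.exists_algEquiv_pow hn hjn
  let f := mapRingHom G (algebraMap ℚ (AlgebraicClosure ℚ))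
  have hfc : f e ∈ Subalgebra.center (AlgebraicClosure ℚ) (MonoidAlgebra (AlgebraicClosure ℚ) G) := by
    refine Subalgebra.mem_center_iff.2 fun b => (commute_of_coeff_conj (fun g h => ?_) b).symm
    simp only [f, coeff_mapRingHom]
    rw [coeff_conj_of_commute (Subalgebra.mem_center_iff.1 hc _).symm]
  have := coeff_pow_of_isIdempotentElem (he.map f) hfc τ hj hτ h
  simpa [f] using this

/-- The eigenvalue of a central element of `K[G]` with rational coefficients, constant on
generators of cyclic subgroups, on a central idempotent is rational. -/
theorem eigenvalue_mem_range_of_coeff_pow {L : Type*} [Field L] [CharZero L]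
    [IsAlgClosure ℚ L]
    {v e : MonoidAlgebra L G} {l : L}
    (hv : ∀ h, v.coeff h ∈ (algebraMap ℚ L).range)
    (hvj : ∀ j : ℕ, j.Coprime (Nat.card G) → ∀ h, v.coeff (h ^ j) = v.coeff h)
    (he : IsIdempotentElem e) (h0 : e ≠ 0)
    (hc : e ∈ Subalgebra.center L (MonoidAlgebra L G))
    (hl : v * e = l • e) : l ∈ (algebraMap ℚ L).range := by
  have := Fintype.ofFinite G
  have : IsAlgClosed L := IsAlgClosure.isAlgClosed ℚ
  have : IsGalois ℚ L := IsAlgClosure.isGalois ℚ L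
  have hn : Nat.card G ≠ 0 := Nat.card_pos.ne'
  have : NeZero ((Nat.card G : ℕ) : L) := ⟨by exact_mod_cast hn⟩
  obtain ⟨ζ, hζ⟩ := HasEnoughRootsOfUnity.exists_primitiveRoot L (Nat.card G)
  suffices ∀ τ : Gal(L/ℚ), τ l = l from (InfiniteGalois.mem_bot_iff_fixed l).2 this
  intro τ
  obtain ⟨j, hj, hjn, hτ⟩ := hζ.exists_coprime_pow hn τ
  have hej := coeff_pow_of_isIdempotentElem he hc τ hj hτ
  have h1 : ∑ h, v.coeff h * e.coeff h⁻¹ = l * e.coeff 1 := by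
    simpa [coeff_mul_eq_sum] using congrArg (fun z => z.coeff 1) hl
  have h2 := congrArg τ h1
  rw [map_sum, map_mul, ← hej 1, one_pow] at h2
  -- Reindexing by the bijection `h ↦ h ^ j` undoes `τ`, so `τ l` and `l` agree after multiplication
  -- by `e.coeff 1 ≠ 0`.
  have h3 : ∑ h, τ (v.coeff h * e.coeff h⁻¹) = ∑ h, v.coeff h * e.coeff h⁻¹ := by
    rw [← (powCoprime hjn.symm).sum_comp fun h => v.coeff h * e.coeff h⁻¹]
    refine Finset.sum_congr rfl fun h _ => ?_
    obtain ⟨q, hq⟩ := hv h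
    rw [map_mul, powCoprime_apply, hvj j hjn, ← inv_pow, hej, ← hq]
    simp
  rw [h3, h1] at h2
  exact (mul_right_cancel₀ (coeff_one_ne_zero_of_isIdempotentElem he h0) h2).symm

end MonoidAlgebra

/-! ### Odd residues modulo powers of two -/

theorem exists_three_pow_sub_one (m : ℕ) :
    ∃ c : ℤ, Odd c ∧ (3 : ℤ) ^ 2 ^ (m + 1) = 1 + 2 ^ (m + 3) * c := by
  induction m with
  | zero => exact ⟨1, odd_one, by norm_num⟩
  | succ m ih =>
    obtain ⟨c, hc, h⟩ := ih
    refine ⟨c + 2 * (2 ^ (m + 1) * c ^ 2), hc.add_even (even_two_mul _), ?_⟩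
    rw [pow_succ 2 (m + 1), pow_mul, h]
    ring

/-- The units modulo a power of `2` are generated by `-1` and `3`. -/
theorem exists_two_pow_dvd_sub_three_pow (m : ℕ) {j : ℤ} (hj : Odd j) :
    ∃ k : ℕ, (2 : ℤ) ^ m ∣ j - 3 ^ k ∨ (2 : ℤ) ^ m ∣ j + 3 ^ k := by
  suffices H : ∀ m : ℕ, ∃ k : ℕ, (2 : ℤ) ^ (m + 3) ∣ j - 3 ^ k ∨ (2 : ℤ) ^ (m + 3) ∣ j + 3 ^ k by
    obtain ⟨k, hk⟩ := H m
    have : (2 : ℤ) ^ m ∣ 2 ^ (m + 3) := pow_dvd_pow 2 (by omega)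
    exact ⟨k, hk.imp this.trans this.trans⟩
  intro m
  induction m with
  | zero =>
    obtain ⟨i, rfl⟩ := hj
    have : i % 4 = 0 ∨ i % 4 = 1 ∨ i % 4 = 2 ∨ i % 4 = 3 := by omega
    rcases this with h | h | h | h
    · exact ⟨0, Or.inl (by norm_num; omega)⟩
    · exact ⟨1, Or.inl (by norm_num; omega)⟩
    · exact ⟨1, Or.inr (by norm_num; omega)⟩
    · exact ⟨0, Or.inr (by norm_num; omega)⟩
  | succ m ih =>
    obtain ⟨c, hc, hpow⟩ := exists_three_pow_sub_one m
    obtain ⟨k, h⟩ := ih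
    have h3 : Odd ((3 : ℤ) ^ k * c) := (Odd.pow (by decide)).mul hc
    have hstep : (3 : ℤ) ^ (k + 2 ^ (m + 1)) = 3 ^ k + 2 ^ (m + 3) * (3 ^ k * c) := by
      rw [pow_add, hpow]
      ring
    -- If `d` is odd, the extra factor `3 ^ 2 ^ (m + 1)` changes `3 ^ k` by an odd multiple of `2 ^
    -- (m + 3)`, which corrects the next binary digit.
    rcases h with ⟨d, hd⟩ | ⟨d, hd⟩ <;> rcases Int.even_or_odd d with he | ho
    · obtain ⟨e, rfl⟩ := he
      exact ⟨k, Or.inl ⟨e, by rw [hd]; ring⟩⟩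
    · obtain ⟨e, he⟩ := ho.sub_odd h3
      exact ⟨k + 2 ^ (m + 1), Or.inl ⟨e, by rw [hstep]; linear_combination hd + 2 ^ (m + 3) * he⟩⟩
    · obtain ⟨e, rfl⟩ := he
      exact ⟨k, Or.inr ⟨e, by rw [hd]; ring⟩⟩
    · obtain ⟨e, he⟩ := ho.add_odd h3
      exact ⟨k + 2 ^ (m + 1), Or.inr ⟨e, by rw [hstep]; linear_combination hd + 2 ^ (m + 3) * he⟩⟩

theorem IsPGroup.apply_pow_eq_of_apply_pow_three {G α : Type*} [Group G] [Finite G]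
    (hG : IsPGroup 2 G) {f : G → α} (h3 : ∀ h, f (h ^ 3) = f h) (hinv : ∀ h, f h⁻¹ = f h)
    {j : ℕ} (hj : j.Coprime (Nat.card G)) (h : G) : f (h ^ j) = f h := by
  obtain ⟨m, hm⟩ := IsPGroup.iff_card.1 hG
  -- For the trivial group, coprimality does not make `j` odd.
  rcases subsingleton_or_nontrivial G with hs | hs
  · rw [Subsingleton.elim (h ^ j) h]
  have hm0 : m ≠ 0 := by
    rintro rfl
    exact (Finite.one_lt_card (α := G)).ne' hm
  have hodd : Odd (j : ℤ) := by
    rw [hm] at hj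
    exact_mod_cast Nat.coprime_two_right.1 ((Nat.coprime_pow_right_iff (by omega) _ _).1 hj)
  have h3k : ∀ k : ℕ, f (h ^ 3 ^ k) = f h := fun k => by
    induction k with
    | zero => simp
    | succ k ih => rw [pow_succ, pow_mul, h3, ih]
  have hz : ∀ a b : ℤ, (2 : ℤ) ^ m ∣ a - b → h ^ a = h ^ b := fun a b hab => by
    refine (orderOf_dvd_sub_iff_zpow_eq_zpow).1 (dvd_trans ?_ hab)
    have := orderOf_dvd_natCard h
    rw [hm] at this
    exact_mod_cast this
  obtain ⟨k, hk | hk⟩ := exists_two_pow_dvd_sub_three_pow m hodd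
  · rw [← zpow_natCast, hz _ _ hk, ← h3k k, ← zpow_natCast]
    norm_cast
  · rw [← zpow_natCast, hz (j : ℤ) (-3 ^ k) (by simpa using hk), zpow_neg, hinv, ← h3k k, ← zpow_natCast]
    norm_cast

/-! ### Inversion and integrality of eigenvalues -/

namespace MonoidAlgebra

variable {R G : Type*} [Group G] [Finite G]

/-- The linear anti-automorphism of the group ring inverting group elements. -/
noncomputable def inversion [CommSemiring R] (a : MonoidAlgebra R G) : MonoidAlgebra R G :=
  ofCoeff (Finsupp.equivFunOnFinite.symm fun g => a.coeff g⁻¹)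

@[simp]
theorem coeff_inversion [CommSemiring R] (a : MonoidAlgebra R G) (g : G) :
    (inversion a).coeff g = a.coeff g⁻¹ := rfl

theorem inversion_mul [CommSemiring R] (a b : MonoidAlgebra R G) :
    inversion (a * b) = inversion b * inversion a := by
  have := Fintype.ofFinite G
  ext g
  rw [coeff_inversion, coeff_mul_eq_sum, coeff_mul_eq_sum]
  refine Fintype.sum_equiv (Equiv.mulLeft g) _ _ fun h => ?_
  simp [mul_comm]

theorem inversion_inversion [CommSemiring R] (a : MonoidAlgebra R G) :
    inversion (inversion a) = a := by
  ext g
  simp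

theorem inversion_one [CommSemiring R] : inversion (1 : MonoidAlgebra R G) = 1 := by
  classical
  ext g
  simp [one_def, Finsupp.single_apply, eq_comm]

theorem coeff_one_mul_inversion [CommSemiring R] [Fintype G] (a : MonoidAlgebra R G) :
    (a * inversion a).coeff 1 = ∑ h, a.coeff h ^ 2 := by
  rw [coeff_mul_eq_sum]
  simp [sq]

theorem commute_inversion [CommSemiring R] {a : MonoidAlgebra R G} (ha : ∀ b, Commute a b)
    (b : MonoidAlgebra R G) : Commute (inversion a) b := by
  have := congrArg inversion (ha (inversion b)).eq
  rw [inversion_mul, inversion_mul, inversion_inversion] at this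
  exact this.symm

/-- An element of `ℤ[G]` whose squared coefficients sum to `1` is a signed group element. -/
theorem eq_or_eq_neg_of_sum_sq_eq_one {G : Type*} [Group G] [Fintype G] {a : MonoidAlgebra ℤ G}
    (ha : ∑ h, a.coeff h ^ 2 = 1) : ∃ g, a = of ℤ G g ∨ a = -of ℤ G g := by
  classical
  obtain ⟨g, hg⟩ : ∃ g, a.coeff g ≠ 0 := by
    by_contra! h
    simp [h] at ha
  have hsplit := Finset.add_sum_erase Finset.univ (fun h => a.coeff h ^ 2) (Finset.mem_univ g)
  have hnn : 0 ≤ ∑ h ∈ Finset.univ.erase g, a.coeff h ^ 2 :=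
    Finset.sum_nonneg fun _ _ => sq_nonneg _
  have hpos : 0 < a.coeff g ^ 2 := by positivity
  have h0 : ∑ h ∈ Finset.univ.erase g, a.coeff h ^ 2 = 0 := by
    linarith
  have hz : ∀ h, h ≠ g → a.coeff h = 0 := fun h hh =>
    pow_eq_zero_iff two_ne_zero |>.1 <| (Finset.sum_eq_zero_iff_of_nonneg fun _ _ => sq_nonneg _).1
      h0 h (Finset.mem_erase.2 ⟨hh, Finset.mem_univ _⟩)
  have h1 : a.coeff g ^ 2 = 1 := by
    linarith
  have heq : ∀ r, a.coeff g = r → a = single g r := fun r hr => by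
    ext h
    rw [coeff_single, Finsupp.single_apply]
    split_ifs with hh
    · rw [← hh, hr]
    · exact hz h (Ne.symm hh)
  refine ⟨g, (sq_eq_one_iff.1 h1).imp (fun h => heq 1 h) fun h => ?_⟩
  rw [heq _ h, of_apply, ← single_neg]

/-- A central element of `L[G]` whose eigenvalues are all `±1` squares to `1`. -/
theorem sq_eq_one_of_forall_eigenvalue {L : Type*} [Field L] [CharZero L] [IsAlgClosed L]
    {v : MonoidAlgebra L G} (hv : v ∈ Subalgebra.center L (MonoidAlgebra L G))
    (h : ∀ (e : MonoidAlgebra L G) (l : L), IsIdempotentElem e → e ≠ 0 →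
      e ∈ Subalgebra.center L (MonoidAlgebra L G) → v * e = l • e → l ^ 2 = 1) : v ^ 2 = 1 := by
  classical
  let Z := Subalgebra.center L (MonoidAlgebra L G)
  have : IsReduced Z := isReduced_center L G
  have : IsArtinianRing Z := IsArtinianRing.of_finite L Z
  let φ := IsArtinianRing.equivPi Z
  suffices (⟨v, hv⟩ : Z) ^ 2 = 1 from congrArg Subtype.val this
  apply φ.injective
  ext I
  have : Module.Finite L (Z ⧸ I.asIdeal) := inferInstance
  let _ : Field (Z ⧸ I.asIdeal) := Ideal.Quotient.field I.asIdeal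
  -- Each residue field of the centre is `L` itself, so `v` acts on the block of `I` as a scalar
  -- `l`.
  obtain ⟨l, hl⟩ := (IsAlgClosed.algebraMap_bijective_of_isIntegral (k := L)
    (K := Z ⧸ I.asIdeal)).2 (φ ⟨v, hv⟩ I)
  let e : Z := φ.symm (Pi.single I 1)
  have he : φ e = Pi.single I 1 := φ.apply_symm_apply _
  have hid : IsIdempotentElem e := by
    apply φ.injective
    rw [map_mul, he, ← Pi.single_mul, mul_one]
  have hne : e ≠ 0 := fun h0 => by
    rw [h0, map_zero] at he
    have := congrFun he I
    simp at this
  have hve : (⟨v, hv⟩ : Z) * e = l • e := by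
    apply φ.injective
    ext J
    rw [Algebra.smul_def, map_mul, map_mul, he, Pi.mul_apply, Pi.mul_apply]
    by_cases hJ : J = I
    · subst hJ
      rw [← hl]
      rfl
    · rw [Pi.single_eq_of_ne hJ, mul_zero, mul_zero]
  have := h e l (congrArg Subtype.val hid) (fun h0 => hne (Subtype.ext h0)) e.2
    (congrArg Subtype.val hve)
  rw [map_pow, Pi.pow_apply, ← hl, ← map_pow, this]
  simp

/-- `ℤ[G]` is integral over `ℤ`; a monic polynomial killing `v` also kills its eigenvalues. -/
theorem isIntegral_eigenvalue {L : Type*} [Field L] (v : MonoidAlgebra ℤ G)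
    {e : MonoidAlgebra L G} {l : L} (h0 : e ≠ 0)
    (hl : mapRingHom G (Int.castRingHom L) v * e = l • e) : IsIntegral ℤ l := by
  obtain ⟨p, hp, hv⟩ := Algebra.IsIntegral.isIntegral (R := ℤ) v
  refine ⟨p, hp, ?_⟩
  let w := mapRingHom G (Int.castRingHom L) v
  have hw : Polynomial.aeval w (p.map (Int.castRingHom L)) = 0 := by
    have := congrArg (mapRingHom G (Int.castRingHom L)) hv
    rw [map_zero, Polynomial.hom_eval₂] at this
    rw [Polynomial.aeval_def, Polynomial.eval₂_map, ← this]
    congr 1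
    exact RingHom.ext_int _ _
  have hev : Module.End.HasEigenvector (Algebra.lmul L (MonoidAlgebra L G) w) l e :=
    ⟨Module.End.mem_eigenspace_iff.2 hl, h0⟩
  have := Module.End.aeval_apply_of_hasEigenvector (p := p.map (Int.castRingHom L)) hev
  rw [Polynomial.aeval_algHom_apply, hw, map_zero, LinearMap.zero_apply, Polynomial.eval_map] at this
  rw [Polynomial.eval₂_congr (RingHom.ext_int _ (Int.castRingHom L)) rfl rfl]
  exact (smul_eq_zero.1 this.symm).resolve_right h0

theorem exists_int_eq_eigenvalue {L : Type*} [Field L] [CharZero L] [IsAlgClosure ℚ L]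
    {v : MonoidAlgebra ℤ G} {e : MonoidAlgebra L G} {l : L}
    (hvj : ∀ j : ℕ, j.Coprime (Nat.card G) → ∀ h, v.coeff (h ^ j) = v.coeff h)
    (he : IsIdempotentElem e) (h0 : e ≠ 0)
    (hc : e ∈ Subalgebra.center L (MonoidAlgebra L G))
    (hl : mapRingHom G (Int.castRingHom L) v * e = l • e) : ∃ m : ℤ, l = m := by
  obtain ⟨q, rfl⟩ := eigenvalue_mem_range_of_coeff_pow
    (fun h => ⟨(v.coeff h : ℚ), by simp⟩) (fun j hj h => by simp [hvj j hj h]) he h0 hc hl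
  have hq : IsIntegral ℤ q :=
    (isIntegral_algebraMap_iff (algebraMap ℚ L).injective).1 (isIntegral_eigenvalue v h0 hl)
  obtain ⟨m, rfl⟩ := IsIntegrallyClosed.isIntegral_iff.1 hq
  exact ⟨m, by simp⟩

/-- Central units of `ℤ[G]` with Galois-invariant coefficients are involutions. -/
theorem sq_eq_one_of_coeff_pow {v w : MonoidAlgebra ℤ G} (hv : ∀ b, Commute v b) (hwv : w * v = 1)
    (hvj : ∀ j : ℕ, j.Coprime (Nat.card G) → ∀ h, v.coeff (h ^ j) = v.coeff h)
    (hwj : ∀ j : ℕ, j.Coprime (Nat.card G) → ∀ h, w.coeff (h ^ j) = w.coeff h) : v ^ 2 = 1 := by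
  have := AlgebraicClosure.isAlgClosure_rat
  let f := mapRingHom G (Int.castRingHom (AlgebraicClosure ℚ))
  have hf : Function.Injective f := fun a b hab => by
    ext g
    have := congrArg (fun z => z.coeff g) hab
    simpa [f] using this
  apply hf
  rw [map_pow, map_one]
  refine sq_eq_one_of_forall_eigenvalue (Subalgebra.mem_center_iff.2 fun b =>
    (commute_of_coeff_conj (fun g h => ?_) b).symm) fun e l he h0 hc hl => ?_
  · simp only [f, coeff_mapRingHom]
    rw [coeff_conj_of_commute (hv _)]
  · have hw : e = l • (f w * e) := by
      rw [← mul_smul_comm, ← hl, ← mul_assoc, ← map_mul, hwv, map_one, one_mul]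
    have hl0 : l ≠ 0 := fun hl0 => h0 (by rw [hw, hl0, zero_smul])
    obtain ⟨m, rfl⟩ := exists_int_eq_eigenvalue hvj he h0 hc hl
    -- The inverse `w` acts by `l⁻¹`, so `l⁻¹` is an integer too.
    obtain ⟨k, hk⟩ := exists_int_eq_eigenvalue hwj he h0 hc
      (show f w * e = (m : AlgebraicClosure ℚ)⁻¹ • e by
        conv_rhs => rw [hw]
        rw [smul_smul, inv_mul_cancel₀ hl0, one_smul])
    have hmk : m * k = 1 := by
      have := mul_inv_cancel₀ hl0
      rw [hk] at this
      exact_mod_cast this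
    rcases Int.eq_one_or_neg_one_of_mul_eq_one hmk with h | h <;> simp [h]

end MonoidAlgebra

/-! ### From conjugacy of cubes to trivial central units -/

open MonoidAlgebra

theorem commute_of_mem_center_units {G : Type*} [Group G] {u : (MonoidAlgebra ℤ G)ˣ}
    (hu : u ∈ Subgroup.center (MonoidAlgebra ℤ G)ˣ) (b : MonoidAlgebra ℤ G) :
    Commute (u : MonoidAlgebra ℤ G) b := by
  refine commute_of_forall_single (fun g => ?_) b
  let x : (MonoidAlgebra ℤ G)ˣ := ⟨single g 1, single g⁻¹ 1, by simp [one_def], by simp [one_def]⟩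
  exact (congrArg Units.val (Subgroup.mem_center_iff.1 hu x)).symm

theorem coeff_eq_of_isConj {G : Type*} [Group G] {a : MonoidAlgebra ℤ G} (ha : ∀ b, Commute a b)
    {x y : G} (h : IsConj x y) : a.coeff x = a.coeff y := by
  obtain ⟨c, rfl⟩ := isConj_iff.1 h
  rw [coeff_conj_of_commute (ha _)]

theorem hasCutProperty_of_forall_isConj {G : Type*} [Group G] [Finite G] (hG : IsPGroup 2 G)
    (h : ∀ x : G, IsConj (x ^ 3) x ∨ IsConj (x ^ 3) x⁻¹) : HasCutProperty G := by
  intro u hu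
  have := Fintype.ofFinite G
  have hc := commute_of_mem_center_units hu
  have hc' := commute_of_mem_center_units (inv_mem hu)
  have key : ∀ a : MonoidAlgebra ℤ G, (∀ b, Commute a b) → ∀ j : ℕ, j.Coprime (Nat.card G) →
      ∀ g, (a * inversion a).coeff (g ^ j) = (a * inversion a).coeff g := fun a ha j hj g => by
    have hsym : ∀ g, (a * inversion a).coeff g⁻¹ = (a * inversion a).coeff g := fun g => by
      rw [← coeff_inversion, inversion_mul, inversion_inversion]
    have hcen : ∀ b, Commute (a * inversion a) b := fun b =>
      (ha b).mul_left (commute_inversion ha b)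
    refine hG.apply_pow_eq_of_apply_pow_three (f := (a * inversion a).coeff) (fun x => ?_) hsym hj g
    rcases h x with hx | hx
    · exact coeff_eq_of_isConj hcen hx
    · rw [coeff_eq_of_isConj hcen hx, hsym]
  set v : MonoidAlgebra ℤ G := u * inversion (u : MonoidAlgebra ℤ G) with hv
  set w : MonoidAlgebra ℤ G := (u⁻¹ : (MonoidAlgebra ℤ G)ˣ) *
    inversion ((u⁻¹ : (MonoidAlgebra ℤ G)ˣ) : MonoidAlgebra ℤ G) with hw
  have hwv : w * v = 1 := by
    rw [hw, hv, (hc (inversion (u : MonoidAlgebra ℤ G))).eq, mul_assoc,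
      ← mul_assoc (inversion _) (inversion _),
      ← inversion_mul, Units.mul_inv, inversion_one, one_mul, Units.inv_mul]
  have hsq := sq_eq_one_of_coeff_pow (fun b => (hc b).mul_left (commute_inversion hc b)) hwv
    (key _ hc) (key _ hc')
  have hinv : inversion v = v := by rw [hv, inversion_mul, inversion_inversion]
  -- Since `v` is symmetric, this sum is the coefficient of `v ^ 2 = 1` at `1`.
  have hvsum : ∑ g, v.coeff g ^ 2 = 1 := by
    rw [← coeff_one_mul_inversion, hinv, ← sq, hsq]
    simp [one_def]
  have hv1 : v.coeff 1 = ∑ g, (u : MonoidAlgebra ℤ G).coeff g ^ 2 := coeff_one_mul_inversion _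
  have hle : v.coeff 1 ^ 2 ≤ 1 := hvsum ▸
    Finset.single_le_sum (f := fun g => v.coeff g ^ 2) (fun _ _ => sq_nonneg _) (Finset.mem_univ 1)
  have hpos : 0 < v.coeff 1 := by
    rw [hv1]
    obtain ⟨g, hg⟩ : ∃ g, (u : MonoidAlgebra ℤ G).coeff g ≠ 0 := by
      by_contra! h0
      exact u.ne_zero (by ext g; exact h0 g)
    exact Finset.sum_pos' (fun _ _ => sq_nonneg _) ⟨g, Finset.mem_univ _, by positivity⟩
  obtain ⟨g, hg⟩ := eq_or_eq_neg_of_sum_sq_eq_one (a := (u : MonoidAlgebra ℤ G))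
    (by rw [← hv1]; nlinarith)
  refine ⟨g, Subgroup.mem_center_iff.2 fun x => ?_, hg⟩
  have hcg : Commute (of ℤ G g) (of ℤ G x) := by
    rcases hg with hg | hg
    · exact hg ▸ hc _
    · exact Commute.neg_left_iff.1 (hg ▸ hc _)
  rw [Commute, SemiconjBy, ← map_mul, ← map_mul] at hcg
  exact (of_injective hcg).symm

/-! ### Units of number fields and their lifts to an order -/

open NumberField in
theorem NumberField.RingOfIntegers.exists_pow_sub_one_mem {K : Type*} [Field K] [NumberField K]
    (ε : (𝓞 K)ˣ) {N : ℕ} (hN : N ≠ 0) :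
    ∃ k : ℕ, 0 < k ∧ (N : 𝓞 K) ∣ ((ε ^ k : (𝓞 K)ˣ) : 𝓞 K) - 1 := by
  let I := Ideal.span {(N : 𝓞 K)}
  have : Finite (𝓞 K ⧸ I) := Ideal.finiteQuotientOfFreeOfNeBot _ (by simp [I, hN])
  refine ⟨Nat.card (𝓞 K ⧸ I)ˣ, Nat.card_pos, ?_⟩
  have h := pow_card_eq_one' (x := Units.map (Ideal.Quotient.mk I).toMonoidHom ε)
  rw [← map_pow] at h
  rw [← Ideal.mem_span_singleton, ← Ideal.Quotient.eq, map_one]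
  exact congrArg Units.val h

-- Denominators are cleared on finitely many generators of `𝓞 K`. The map `ι` is non-unital because
-- a field factor sits in the ring with an idempotent as its unit.
open NumberField in
theorem NumberField.exists_natCast_mul_mem_range {K A B : Type*} [Field K] [NumberField K]
    [Ring A] [Ring B] (f : A →+* B) (hf : ∀ b, ∃ N : ℕ, N ≠ 0 ∧ (N : B) * b ∈ f.range)
    (ι : K →ₙ+* B) : ∃ N : ℕ, N ≠ 0 ∧ ∀ y : 𝓞 K, ι ((N : K) * y) ∈ f.range := by
  classical
  obtain ⟨s, hs⟩ := (Module.Finite.fg_top : (⊤ : Submodule ℤ (𝓞 K)).FG)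
  choose d hd hdm using fun y : 𝓞 K => hf (ι y)
  refine ⟨∏ y ∈ s, d y, Finset.prod_ne_zero_iff.2 fun y _ => hd y, fun y => ?_⟩
  have hnat : ∀ (m : ℕ) (x : K), ι ((m : K) * x) = (m : B) * ι x := fun m x => by
    rw [← nsmul_eq_mul, map_nsmul, nsmul_eq_mul]
  rw [hnat]
  have hy : y ∈ Submodule.span ℤ (s : Set (𝓞 K)) := hs ▸ Submodule.mem_top
  induction hy using Submodule.span_induction with
  | mem x hx =>
    rw [← Finset.prod_erase_mul s d hx, Nat.cast_mul, mul_assoc]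
    exact mul_mem (natCast_mem _ _) (hdm x)
  | zero => simp
  | add x y _ _ hx hy =>
    rw [show ((x + y : 𝓞 K) : K) = x + y from map_add _ _ _, map_add, mul_add]
    exact add_mem hx hy
  | smul a x _ hx =>
    have : ι ((a • x : 𝓞 K) : K) = a • ι x := by
      rw [← map_zsmul]
      congr 1
    rw [this, mul_smul_comm]
    exact zsmul_mem hx a

-- The unit is `ε ^ k` on the factor `K` and `1` on the complement. With `k` chosen so that `N`
-- divides `ε ^ k - 1`, both it and its inverse lie in the image of `A`.
open NumberField in
theorem NumberField.exists_unit_eq_one_add {K A B : Type*} [Field K] [NumberField K]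
    [Ring A] [Ring B] (f : A →+* B) (hinj : Function.Injective f)
    (hf : ∀ b, ∃ N : ℕ, N ≠ 0 ∧ (N : B) * b ∈ f.range) (ι : K →ₙ+* B) (ε : (𝓞 K)ˣ) :
    ∃ (k : ℕ) (u : Aˣ), 0 < k ∧ f u = 1 + ι (((ε ^ k : (𝓞 K)ˣ) : K) - 1) := by
  obtain ⟨N, hN, hNm⟩ := exists_natCast_mul_mem_range f hf ι
  obtain ⟨k, hk, c, hc⟩ := RingOfIntegers.exists_pow_sub_one_mem ε hN
  let η := ε ^ k
  have hη : (((η⁻¹ : (𝓞 K)ˣ) : 𝓞 K) : K) * (η : 𝓞 K) = 1 := by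
    rw [← map_mul, Units.inv_mul, map_one]
  have hcK : ((η : 𝓞 K) : K) - 1 = (N : K) * c := by
    have := congrArg (algebraMap (𝓞 K) K) hc
    rwa [map_sub, map_mul, map_one, map_natCast] at this
  have hcK' : (((η⁻¹ : (𝓞 K)ˣ) : 𝓞 K) : K) - 1 = (N : K) * ((-(η⁻¹ : (𝓞 K)ˣ) * c : 𝓞 K) : K) := by
    have : ((-(η⁻¹ : (𝓞 K)ˣ) * c : 𝓞 K) : K) = -((η⁻¹ : (𝓞 K)ˣ) : 𝓞 K) * (c : K) := by simp
    rw [this]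
    linear_combination (-(((η⁻¹ : (𝓞 K)ˣ) : 𝓞 K) : K)) * hcK + hη
  obtain ⟨a, ha⟩ := hNm c
  obtain ⟨b, hb⟩ := hNm (-(η⁻¹ : (𝓞 K)ˣ) * c)
  rw [← hcK] at ha
  rw [← hcK'] at hb
  have hmul : ∀ x y : K, x * y = 1 → (1 + ι (x - 1)) * (1 + ι (y - 1)) = 1 := fun x y hxy => by
    have : (1 + ι (x - 1)) * (1 + ι (y - 1)) =
        1 + (ι (x - 1) + ι (y - 1) + ι (x - 1) * ι (y - 1)) := by noncomm_ring
    rw [this, ← map_mul, ← map_add, ← map_add]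
    have h0 : x - 1 + (y - 1) + (x - 1) * (y - 1) = 0 := by linear_combination hxy
    rw [h0, map_zero, add_zero]
  refine ⟨k, ⟨1 + a, 1 + b, hinj ?_, hinj ?_⟩, hk, ?_⟩
  · rw [map_mul, map_add, map_add, map_one, ha, hb, hmul _ _ (by rw [mul_comm, hη])]
  · rw [map_mul, map_add, map_add, map_one, ha, hb, hmul _ _ hη]
  · change f (1 + a) = _
    rw [map_add, map_one, ha]

open NumberField Module in
/-- A totally real number field whose units are all torsion is `ℚ`. -/
theorem NumberField.finrank_eq_one_of_isOfFinOrder {K : Type*} [Field K] [NumberField K]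
    [IsTotallyReal K] (h : ∀ ε : (𝓞 K)ˣ, IsOfFinOrder ε) : finrank ℚ K = 1 := by
  have htop : Units.torsion K = ⊤ := by
    rw [eq_top_iff]
    exact fun ε _ => (CommGroup.mem_torsion ε).2 (h ε)
  have : Subsingleton (Units.unitLattice K) := by
    refine ⟨?_⟩
    rintro ⟨_, x, -, rfl⟩ ⟨_, y, -, rfl⟩
    have h0 : ∀ x : Additive (𝓞 K)ˣ, Units.logEmbedding K x = 0 := fun x =>
      Units.dirichletUnitTheorem.logEmbedding_eq_zero_iff.2 (htop ▸ Subgroup.mem_top x.toMul)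
    exact Subtype.ext ((h0 x).trans (h0 y).symm)
  have hr : Units.rank K = 0 := by
    rw [← Units.unitLattice_rank]
    exact finrank_zero_of_subsingleton
  -- The unit rank is the number of infinite places minus one, here the degree minus one.
  have hc : Fintype.card (InfinitePlace K) = finrank ℚ K := by
    rw [IsTotallyReal.finrank, InfinitePlace.card_eq_nrRealPlaces_add_nrComplexPlaces,
      IsTotallyReal.nrComplexPlaces_eq_zero, add_zero]
  rw [Units.rank, hc] at hr
  have : 0 < finrank ℚ K := finrank_pos
  omega

/-! ### The symmetric centre of the rational group ring -/

namespace MonoidAlgebra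

variable {G : Type*} [Group G] [Finite G]

theorem exists_natCast_mul_mem_range_mapRingHom (b : MonoidAlgebra ℚ G) :
    ∃ N : ℕ, N ≠ 0 ∧ (N : MonoidAlgebra ℚ G) * b ∈ (mapRingHom G (Int.castRingHom ℚ)).range := by
  classical
  have := Fintype.ofFinite G
  let N := ∏ g, (b.coeff g).den
  refine ⟨N, Finset.prod_ne_zero_iff.2 fun g _ => (b.coeff g).den_ne_zero, ?_⟩
  have h : ∀ g, ∃ m : ℤ, (m : ℚ) = N * b.coeff g := fun g => by
    refine ⟨(∏ x ∈ Finset.univ.erase g, (b.coeff x).den : ℕ) * (b.coeff g).num, ?_⟩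
    have hN : N = (∏ x ∈ Finset.univ.erase g, (b.coeff x).den) * (b.coeff g).den :=
      (Finset.prod_erase_mul _ _ (Finset.mem_univ g)).symm
    rw [hN]
    push_cast
    rw [mul_assoc, mul_comm ((b.coeff g).den : ℚ), Rat.mul_den_eq_num]
  choose m hm using h
  refine ⟨ofCoeff (Finsupp.equivFunOnFinite.symm m), ?_⟩
  ext g
  have hN : ((N : MonoidAlgebra ℚ G) * b).coeff g = N * b.coeff g := by
    rw [natCast_def, coeff_single_one_mul]
  rw [hN, ← hm]
  rfl

/-- The symmetric elements of the centre of `ℚ[G]`. -/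
noncomputable def symmetricCenter (G : Type*) [Group G] [Finite G] :
    Subalgebra ℚ (MonoidAlgebra ℚ G) where
  carrier := {z | (∀ b, Commute z b) ∧ inversion z = z}
  mul_mem' {a b} ha hb :=
    ⟨fun c => (ha.1 c).mul_left (hb.1 c), by rw [inversion_mul, ha.2, hb.2, (ha.1 b).eq]⟩
  add_mem' {a b} ha hb := by
    refine ⟨fun c => (ha.1 c).add_left (hb.1 c), ?_⟩
    ext g
    exact congrArg₂ (· + ·) (congrArg (fun z => z.coeff g) ha.2)
      (congrArg (fun z => z.coeff g) hb.2)
  algebraMap_mem' r := by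
    classical
    refine ⟨Algebra.commute_algebraMap_left r, ?_⟩
    ext g
    simp [Finsupp.single_apply, eq_comm]

noncomputable instance (G : Type*) [Group G] [Finite G] : CommRing (symmetricCenter G) :=
  { (inferInstance : Ring (symmetricCenter G)) with
    mul_comm := fun a b => Subtype.ext (a.2.1 b).eq }

/-- In the group basis, multiplication by `s` is a rational symmetric matrix, so its characteristic
polynomial has only real roots, and `φ s` is one of them. -/
theorem im_eq_zero_of_symmetricCenter (φ : symmetricCenter G →+* ℂ) (s : symmetricCenter G) :
    (φ s).im = 0 := by
  classical
  have := Fintype.ofFinite G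
  let z : MonoidAlgebra ℚ G := s
  have hz : inversion z = z := s.2.2
  let b := MonoidAlgebra.basis G ℚ
  let A := Algebra.leftMulMatrix b z
  have hA : ∀ i j, A i j = z.coeff (i * j⁻¹) := fun i j => by
    change Algebra.leftMulMatrix b z i j = _
    rw [Algebra.leftMulMatrix_eq_repr_mul, basis_apply]
    change (z * single j 1).coeff i = _
    rw [coeff_mul_single', mul_one]
  have hH : (A.map (algebraMap ℚ ℂ)).IsHermitian := by
    ext i j
    rw [Matrix.conjTranspose_apply, Matrix.map_apply, Matrix.map_apply, hA, hA, ← hz,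
      coeff_inversion, hz]
    simp
  have h0 : Polynomial.aeval z A.charpoly = 0 := by
    apply Algebra.leftMulMatrix_injective b
    rw [← Polynomial.aeval_algHom_apply, map_zero, Matrix.aeval_self_charpoly]
  have h1 : Polynomial.aeval s A.charpoly = 0 := by
    apply Subtype.val_injective
    have := Polynomial.aeval_algHom_apply (symmetricCenter G).val s A.charpoly
    exact this.symm.trans h0
  have h2 : (A.map (algebraMap ℚ ℂ)).charpoly.eval (φ s) = 0 := by
    rw [Matrix.charpoly_map, Polynomial.eval_map]
    have := congrArg φ h1
    rw [map_zero, Polynomial.aeval_def, Polynomial.hom_eval₂] at this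
    rw [← this]
    congr 1
    exact Subsingleton.elim _ _
  rw [hH.charpoly_eq, Polynomial.eval_prod, Finset.prod_eq_zero_iff] at h2
  obtain ⟨i, -, hi⟩ := h2
  rw [Polynomial.eval_sub, Polynomial.eval_X, Polynomial.eval_C, sub_eq_zero] at hi
  rw [hi]
  exact Complex.ofReal_im _

end MonoidAlgebra

/-! ### From trivial central units to conjugacy of cubes -/

open MonoidAlgebra NumberField

theorem HasCutProperty.isOfFinOrder_units {G : Type*} [Group G] [Finite G] (hcut : HasCutProperty G)
    {K : Type*} [Field K] [NumberField K] (ι : K →ₙ+* MonoidAlgebra ℚ G)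
    (hinj : Function.Injective ι) (hc : ∀ x b, Commute (ι x) b) (ε : (𝓞 K)ˣ) :
    IsOfFinOrder ε := by
  let f := mapRingHom G (Int.castRingHom ℚ)
  have hf : Function.Injective f := fun a b hab => by
    ext g
    have := congrArg (fun z => z.coeff g) hab
    simpa [f] using this
  obtain ⟨k, u, hk, hu⟩ :=
    exists_unit_eq_one_add f hf exists_natCast_mul_mem_range_mapRingHom ι ε
  have hucen : u ∈ Subgroup.center (MonoidAlgebra ℤ G)ˣ := by
    refine Subgroup.mem_center_iff.2 fun w => Units.ext (hf ?_)
    rw [Units.val_mul, Units.val_mul, map_mul, map_mul, hu]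
    exact ((Commute.one_left _).add_left (hc _ _)).eq.symm
  obtain ⟨g, -, hg⟩ := hcut u hucen
  have hn : Nat.card G ≠ 0 := Nat.card_pos.ne'
  -- The factor `2` removes the sign in `±g`.
  have hu1 : (u : MonoidAlgebra ℤ G) ^ (2 * Nat.card G) = 1 := by
    have : (of ℤ G g) ^ (2 * Nat.card G) = 1 := by
      rw [← map_pow, mul_comm, pow_mul, pow_card_eq_one', one_pow, map_one]
    rcases hg with hg | hg
    · rw [hg, this]
    · rw [hg, (even_two_mul _).neg_pow, this]
  have hpow : ∀ (x : K) (m : ℕ), (1 + ι (x - 1)) ^ m = 1 + ι (x ^ m - 1) := fun x m => by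
    induction m with
    | zero => simp
    | succ m ih =>
      have : (1 + ι (x ^ m - 1)) * (1 + ι (x - 1)) =
        1 + (ι (x ^ m - 1) + ι (x - 1) + ι (x ^ m - 1) * ι (x - 1)) := by noncomm_ring
      rw [pow_succ, ih, this, ← map_mul, ← map_add, ← map_add]
      congr 2
      ring
  have h1 := congrArg f hu1
  rw [map_pow, hu, hpow, map_one, add_eq_left, ← map_zero ι] at h1
  have h2 := sub_eq_zero.1 (hinj h1)
  refine isOfFinOrder_iff_pow_eq_one.2 ⟨k * (2 * Nat.card G), by positivity, ?_⟩
  apply Units.ext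
  apply RingOfIntegers.coe_injective
  rw [pow_mul]
  simpa using h2

theorem HasCutProperty.exists_rat_eq {G : Type*} [Group G] [Finite G] (hcut : HasCutProperty G)
    {K : Type*} [Field K] (π : symmetricCenter G →+* K) (hπ : Function.Surjective π)
    (ι : K →ₙ+* symmetricCenter G) (hinj : Function.Injective ι) (x : K) : ∃ q : ℚ, (q : K) = x := by
  have : CharZero K := charZero_of_injective_ringHom (π.comp (algebraMap ℚ _)).injective
  have : FiniteDimensional ℚ K := Module.Finite.of_surjective π.toRatAlgHom.toLinearMap hπ
  have : NumberField K := ⟨⟩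
  have : IsTotallyReal K := ⟨fun v => InfinitePlace.isReal_iff.2 <| by
    rw [ComplexEmbedding.isReal_iff]
    ext y
    obtain ⟨s, rfl⟩ := hπ y
    exact Complex.conj_eq_iff_im.2 (im_eq_zero_of_symmetricCenter (v.embedding.comp π) s)⟩
  let j : K →ₙ+* MonoidAlgebra ℚ G :=
    (((symmetricCenter G).val :
      symmetricCenter G →+* MonoidAlgebra ℚ G) : symmetricCenter G →ₙ+* MonoidAlgebra ℚ G).comp ι
  have h1 := finrank_eq_one_of_isOfFinOrder (K := K) (hcut.isOfFinOrder_units j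
    (fun a b hab => hinj (Subtype.val_injective hab))
    fun a b => (ι a).2.1 b)
  obtain ⟨q, hq⟩ := (finrank_eq_one_iff_of_nonzero' (1 : K) one_ne_zero).1 h1 x
  exact ⟨q, by rw [← hq, Rat.smul_one_eq_cast]⟩

theorem HasCutProperty.coeff_pow_three {G : Type*} [Group G] [Finite G] (hcut : HasCutProperty G)
    (h3 : Nat.Coprime 3 (Nat.card G)) (s : symmetricCenter G) (h : G) :
    (s : MonoidAlgebra ℚ G).coeff (h ^ 3) = (s : MonoidAlgebra ℚ G).coeff h := by
  classical
  let S := symmetricCenter G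
  have : IsReduced S := by
    have := isReduced_center ℚ G
    exact isReduced_of_injective (Subalgebra.inclusion fun z hz =>
      Subalgebra.mem_center_iff.2 fun b => (hz.1 b).symm : S →ₐ[ℚ] _)
      (Subalgebra.inclusion_injective _)
  have : IsArtinianRing S := IsArtinianRing.of_finite ℚ S
  have := Fintype.ofFinite (MaximalSpectrum S)
  let φ := IsArtinianRing.equivPi S
  -- Every field factor is `ℚ`, so each component of `s` is a rational multiple of its block
  -- idempotent.
  have hcomp : ∀ I : MaximalSpectrum S, ∃ (q : ℚ) (e : S), IsIdempotentElem e ∧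
      φ.symm (Pi.single I (φ s I)) = q • e := fun I => by
    let _ : Field (S ⧸ I.asIdeal) := Ideal.Quotient.field I.asIdeal
    let ι : S ⧸ I.asIdeal →ₙ+* S :=
      { toFun := fun x => φ.symm (Pi.single I x)
        map_mul' := fun x y => by rw [Pi.single_mul, map_mul]
        map_zero' := by rw [Pi.single_zero, map_zero]
        map_add' := fun x y => by rw [Pi.single_add, map_add] }
    obtain ⟨q, hq⟩ := hcut.exists_rat_eq (Ideal.Quotient.mk I.asIdeal)
      Ideal.Quotient.mk_surjective ι
      (fun x y hxy => Pi.single_injective I (φ.symm.injective hxy)) (φ s I)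
    refine ⟨q, ι 1, ?_, ?_⟩
    · rw [IsIdempotentElem, ← map_mul, mul_one]
    · rw [← hq]
      apply φ.injective
      ext J
      rw [Algebra.smul_def, map_mul, Pi.mul_apply]
      change φ (φ.symm _) J = _ * φ (φ.symm _) J
      rw [φ.apply_symm_apply, φ.apply_symm_apply]
      by_cases hJ : J = I
      · subst hJ
        rw [Pi.single_eq_same, Pi.single_eq_same, mul_one]
        exact (eq_ratCast ((Ideal.Quotient.mk J.asIdeal).comp (algebraMap ℚ S)) _).symm
      · rw [Pi.single_eq_of_ne hJ, Pi.single_eq_of_ne hJ, mul_zero]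
  choose q e he hqe using hcomp
  have hs : s = ∑ I, q I • e I := by
    rw [← Finset.sum_congr rfl fun I _ => hqe I, ← map_sum, Finset.univ_sum_single,
      φ.symm_apply_apply]
  have hs' : (s : MonoidAlgebra ℚ G) = ∑ I, q I • (e I : MonoidAlgebra ℚ G) := by
    conv_lhs => rw [hs]
    simp
  have hcoeff : ∀ g, (s : MonoidAlgebra ℚ G).coeff g =
      ∑ I, q I * (e I : MonoidAlgebra ℚ G).coeff g := fun g => by
    rw [hs']
    simp
  rw [hcoeff, hcoeff]
  refine Finset.sum_congr rfl fun I _ => ?_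
  rw [coeff_pow_of_isIdempotentElem_rat (congrArg Subtype.val (he I))
    (Subalgebra.mem_center_iff.2 fun b => ((e I).2.1 b).symm) three_ne_zero h3]

theorem forall_isConj_of_hasCutProperty {G : Type*} [Group G] [Finite G] (hG : IsPGroup 2 G)
    (hcut : HasCutProperty G) (x : G) : IsConj (x ^ 3) x ∨ IsConj (x ^ 3) x⁻¹ := by
  classical
  have h3 : Nat.Coprime 3 (Nat.card G) := by
    obtain ⟨m, hm⟩ := IsPGroup.iff_card.1 hG
    rw [hm]
    exact Nat.Coprime.pow_right _ (by norm_num)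
  let a : MonoidAlgebra ℚ G := ofCoeff (Finsupp.equivFunOnFinite.symm fun g =>
    if IsConj g x ∨ IsConj g x⁻¹ then 1 else 0)
  have ha : ∀ g, a.coeff g = if IsConj g x ∨ IsConj g x⁻¹ then 1 else 0 := fun g => rfl
  have hac : ∀ b, Commute a b := by
    refine commute_of_coeff_conj fun g h => ?_
    have : IsConj h (g * h * g⁻¹) := isConj_iff.2 ⟨g, rfl⟩
    rw [ha, ha]
    congr 1
    exact propext (or_congr ⟨this.trans, this.symm.trans⟩ ⟨this.trans, this.symm.trans⟩)
  have hsym : inversion a = a := by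
    have hinv : ∀ y z : G, IsConj y⁻¹ z ↔ IsConj y z⁻¹ := fun y z => by
      simp only [isConj_iff]
      refine exists_congr fun c => ?_
      rw [← conj_inv, inv_eq_iff_eq_inv]
    ext g
    rw [coeff_inversion, ha, ha]
    congr 1
    rw [hinv, hinv, inv_inv, or_comm]
  have := hcut.coeff_pow_three h3 ⟨a, hac, hsym⟩ x
  change a.coeff (x ^ 3) = a.coeff x at this
  rw [ha, ha, if_pos (Or.inl (IsConj.refl x))] at this
  by_contra hne
  rw [if_neg hne] at this
  exact zero_ne_one this

/-! ### Exponents of central sections -/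

theorem Monoid.exponent_mem_two_four {Q : Type*} [Group Q] [Nontrivial Q]
    (h : ∀ q : Q, q ^ 4 = 1) : Monoid.exponent Q ∈ ({2, 4} : Set ℕ) := by
  have h4 : Monoid.exponent Q ∣ 2 ^ 2 := Monoid.exponent_dvd_of_forall_pow_eq_one h
  obtain ⟨k, hk, he⟩ := (Nat.dvd_prime_pow Nat.prime_two).1 h4
  rw [he]
  interval_cases k
  · exact absurd (Monoid.exp_eq_one_iff.1 he) (not_subsingleton Q)
  · simp
  · simp

theorem exponent_quotient_mem_two_four {G : Type*} [Group G]
    (h : ∀ x : G, IsConj (x ^ 3) x ∨ IsConj (x ^ 3) x⁻¹) {N H : Subgroup G} [N.Normal]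
    (hN : ∀ x ∈ H, ∀ g, x * g * x⁻¹ * g⁻¹ ∈ N) (hNH : ¬ H ≤ N) :
    Monoid.exponent (H ⧸ N.subgroupOf H) ∈ ({2, 4} : Set ℕ) := by
  have : Nontrivial (H ⧸ N.subgroupOf H) := by
    rw [QuotientGroup.nontrivial_iff, Ne, Subgroup.subgroupOf_eq_top]
    exact hNH
  refine Monoid.exponent_mem_two_four fun q => ?_
  induction q using QuotientGroup.induction_on with
  | H x =>
    obtain ⟨x, hx⟩ := x
    rw [← QuotientGroup.mk_pow, QuotientGroup.eq_one_iff, Subgroup.mem_subgroupOf]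
    change x ^ 4 ∈ N
    -- The image of `x` is central modulo `N`, so conjugacy becomes equality there.
    have hq : ∀ g : G, (QuotientGroup.mk' N) (g * x * g⁻¹) = QuotientGroup.mk' N x := fun g => by
      have := hN x hx g
      rw [← QuotientGroup.ker_mk' N, MonoidHom.mem_ker] at this
      simp only [map_mul, map_inv] at this ⊢
      rw [mul_inv_eq_one, mul_inv_eq_iff_eq_mul] at this
      rw [← this, mul_inv_cancel_right]
    rw [← QuotientGroup.ker_mk' N, MonoidHom.mem_ker, map_pow]
    set y := QuotientGroup.mk' N x
    rcases h x with h | h <;> obtain ⟨c, hc⟩ := isConj_iff.1 h.symm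
    · have h3 := congrArg (QuotientGroup.mk' N) hc
      rw [hq, map_pow] at h3
      have h2 : y ^ 2 = 1 := by
        rw [pow_succ] at h3
        exact (mul_right_cancel (b := y) (by rw [one_mul]; exact h3)).symm
      rw [show (4 : ℕ) = 2 * 2 from rfl, pow_mul, h2, one_pow]
    · have h3 := congrArg (QuotientGroup.mk' N) hc
      have : c * x⁻¹ * c⁻¹ = (c * x * c⁻¹)⁻¹ := by group
      rw [this, map_inv, hq, map_pow] at h3
      rw [pow_succ, ← h3]
      exact inv_mul_cancel y

theorem exponent_series_of_isConj {G : Type*} [Group G]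
    (h : ∀ x : G, IsConj (x ^ 3) x ∨ IsConj (x ^ 3) x⁻¹) :
      (∀ i : ℕ,
        (⊤ : Subgroup G).lowerCentralSeries (i + 1) ≠ (⊤ : Subgroup G).lowerCentralSeries i →
        Monoid.exponent ((⊤ : Subgroup G).lowerCentralSeries i ⧸
          ((⊤ : Subgroup G).lowerCentralSeries (i + 1)).subgroupOf
            ((⊤ : Subgroup G).lowerCentralSeries i)) ∈ ({2, 4} : Set ℕ)) ∧
      (∀ i : ℕ,
        Subgroup.upperCentralSeries G i ≠ Subgroup.upperCentralSeries G (i + 1) →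
        Monoid.exponent (Subgroup.upperCentralSeries G (i + 1) ⧸
          (Subgroup.upperCentralSeries G i).subgroupOf
            (Subgroup.upperCentralSeries G (i + 1))) ∈ ({2, 4} : Set ℕ)) := by
  refine ⟨fun i hi => ?_, fun i hi => ?_⟩
  · exact exponent_quotient_mem_two_four h
      (fun x hx g => Subgroup.commutator_mem_commutator hx (Subgroup.mem_top g))
      fun hle => hi (le_antisymm (Subgroup.lowerCentralSeries_antitone _ i.le_succ) hle)
  · exact exponent_quotient_mem_two_four h
      (fun x hx g => (Subgroup.mem_upperCentralSeries_succ_iff).1 hx g)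
      fun hle => hi (le_antisymm (Subgroup.upperCentralSeries_mono G i.le_succ) hle)

theorem theorem2p4 (G : Type*) [Group G] [Finite G] (hG : IsPGroup 2 G) :
    (HasCutProperty G ↔ ∀ x : G, IsConj (x ^ 3) x ∨ IsConj (x ^ 3) x⁻¹) ∧
    (HasCutProperty G →
      (∀ i : ℕ,
        (⊤ : Subgroup G).lowerCentralSeries (i + 1) ≠ (⊤ : Subgroup G).lowerCentralSeries i →
        Monoid.exponent ((⊤ : Subgroup G).lowerCentralSeries i ⧸
          ((⊤ : Subgroup G).lowerCentralSeries (i + 1)).subgroupOf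
            ((⊤ : Subgroup G).lowerCentralSeries i)) ∈ ({2, 4} : Set ℕ)) ∧
      (∀ i : ℕ,
        Subgroup.upperCentralSeries G i ≠ Subgroup.upperCentralSeries G (i + 1) →
        Monoid.exponent (Subgroup.upperCentralSeries G (i + 1) ⧸
          (Subgroup.upperCentralSeries G i).subgroupOf
            (Subgroup.upperCentralSeries G (i + 1))) ∈ ({2, 4} : Set ℕ))) :=
  ⟨⟨forall_isConj_of_hasCutProperty hG, hasCutProperty_of_forall_isConj hG⟩,
    fun hcut => exponent_series_of_isConj (forall_isConj_of_hasCutProperty hG hcut)⟩
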